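/- Let $(A,\mathfrak m,k)$ be a commutative Noetherian local ring; all modules are finitely generated. For an $A$-module $X$ with minimal free resolution $\cdots\to F_1\to F_0\to X\to 0$, let $\beta_n(X)=\operatorname{rank}F_n$, and let $\Omega^n_A(X)$ denote the $n$th syzygy of $X$, with $\Omega^0_A(X)=X$. The complexity of $X$ is $$\operatorname{cx}X=\inf\{t\in\mathbb N\cup\{0\}\mid \exists\,a\in\mathbb R \text{ such that } \beta_n(X)\le a\,n^{t-1}\text{ for } n\gg 0\}\in\mathbb N\cup\{0,\infty\}.$$ For $t\ge 1$ and $\eta\in\operatorname{Ext}^t_A(X,X)$ represented by a map $f_\eta\colon\Omega^t_A(X)\to X$, let $K_\eta$ be the pushout of $f_\eta$ along the inclusion $\Omega^t_A(X)\hookrightarrow F_{t-1}$; up to isomorphism it depends only on $\eta$. The class $\mathcal C^{frc}_A$ of modules of free reducible complexity is defined inductively as follows: (i) every module of finite projective dimension belongs to $\mathcal C^{frc}_A$; (ii) a module $X$ with $0<\operatorname{cx}X<\infty$ belongs to $\mathcal C^{frc}_A$ if there is a homogeneous element $\eta\in\operatorname{Ext}^*_A(X,X)$ of positive degree such that $\operatorname{cx}K_\eta=\operatorname{cx}X-1$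 and $K_\eta\in\mathcal C^{frc}_A$. Let $M\in\mathcal C^{frc}_A$. Then $M$ has finite projective dimension if and only if for every $N\in\mathcal C^{frc}_A$ with $\operatorname{cx}N=1$ one has $\operatorname{Ext}^i_A(M,N)=0$ for all $i\gg 0$ (where the bound on $i$ may depend on $N$). -/

import Mathlib

universe u

open CategoryTheory Abelian

noncomputable section

namespace FreeRedCx

variable {A : Type u} [CommRing A]

/-- The free module on a generating set of `M` of minimal cardinality. -/
abbrev minimalFreeCover (M : ModuleCat.{u} A) : Type u :=
  (Submodule.generators (⊤ : Submodule A M)) →₀ A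

/-- The canonical map from the minimal free cover of `M` to `M`. -/
def coverMap (M : ModuleCat.{u} A) : minimalFreeCover M →ₗ[A] M :=
  Finsupp.linearCombination A
    (Subtype.val : (Submodule.generators (⊤ : Submodule A M)) → M)

theorem coverMap_surjective (M : ModuleCat.{u} A) : Function.Surjective (coverMap M) := by
  rw [← LinearMap.range_eq_top, coverMap, Finsupp.range_linearCombination, Subtype.range_coe]
  exact Submodule.span_generators _

/-- The complex `0 → Ω M → F → M → 0`, where `F → M` is the minimal free cover of `M`
and `Ω M` is its kernel. -/
abbrev coverSequence (M : ModuleCat.{u} A) : ShortComplex (ModuleCat.{u} A) :=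
  (coverMap M).shortComplexKer

theorem coverSequence_shortExact (M : ModuleCat.{u} A) : (coverSequence M).ShortExact :=
  LinearMap.shortExact_shortComplexKer (coverMap_surjective M)

/-- The syzygies of `M`: `Ω⁰ M = M`, and `Ωⁿ⁺¹ M` is the kernel of the minimal free cover of
`Ωⁿ M`. For finitely generated modules over a Noetherian local ring, splicing the minimal free
covers of the `Ωⁿ M` gives the minimal free resolution `⋯ → F₁ → F₀ → M → 0`, whose `n`-th term
`Fₙ` is the minimal free cover of `Ωⁿ M`. -/
def syzygy (M : ModuleCat.{u} A) : ℕ → ModuleCat.{u} A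
  | 0 => M
  | n + 1 => (coverSequence (syzygy M n)).X₁

/-- The exact sequence `0 → Ωⁿ⁺¹ M → Fₙ → Ωⁿ M → 0`. -/
abbrev syzygySequence (M : ModuleCat.{u} A) (n : ℕ) : ShortComplex (ModuleCat.{u} A) :=
  coverSequence (syzygy M n)

/-- The inclusion `Ωⁿ⁺¹ M → Fₙ`. -/
def syzygyInclusion (M : ModuleCat.{u} A) (n : ℕ) :
    syzygy M (n + 1) ⟶ (syzygySequence M n).X₂ :=
  (syzygySequence M n).f

/-- The `n`-th Betti number of `M`: the rank of the `n`-th free module in its minimal free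
resolution. -/
def betti (M : ModuleCat.{u} A) (n : ℕ) : ℕ :=
  Module.finrank A (minimalFreeCover (syzygy M n))

/-- The complexity of `M`: the infimum (possibly `⊤`) of the natural numbers `t` such that, for
some real `a`, one has `βₙ(M) ≤ a * n ^ (t - 1)` for all large `n`. The exponent is an integer
and may be `-1`. -/
def complexity (M : ModuleCat.{u} A) : ℕ∞ :=
  sInf {c : ℕ∞ | ∃ t : ℕ, c = t ∧
    ∃ a : ℝ, ∀ᶠ n : ℕ in Filter.atTop, (betti M n : ℝ) ≤ a * (n : ℝ) ^ ((t : ℤ) - 1)}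

/-- The class in `Extⁿ(M, Ωⁿ M)` of `0 → Ωⁿ M → Fₙ₋₁ → ⋯ → F₀ → M → 0`, the Yoneda product of
the classes of the sequences `0 → Ωⁱ⁺¹ M → Fᵢ → Ωⁱ M → 0`. -/
def syzygyClass (M : ModuleCat.{u} A) : (n : ℕ) → Ext.{u} M (syzygy M n) n
  | 0 => Ext.mk₀ (𝟙 M)
  | n + 1 => (syzygyClass M n).comp (coverSequence_shortExact (syzygy M n)).extClass rfl

/-- The map `f : Ωⁿ M ⟶ N` represents `η ∈ Extⁿ(M, N)`. -/
def Represents {M N : ModuleCat.{u} A} {n : ℕ} (f : syzygy M n ⟶ N) (η : Ext.{u} M N n) : Prop :=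
  (syzygyClass M n).comp (Ext.mk₀ f) (add_zero n) = η

/-- Every class in `Extⁿ(M, N)` is represented by a map `Ωⁿ M ⟶ N`, also for `n = 0`. -/
theorem exists_represents {M N : ModuleCat.{u} A} {n : ℕ} (η : Ext.{u} M N n) :
    ∃ f : syzygy M n ⟶ N, Represents f η := by
  have key : ∀ (s r n : ℕ) (h : s + r = n) (η : Ext.{u} M N n),
      ∃ ξ : Ext.{u} (syzygy M s) N r, (syzygyClass M s).comp ξ h = η := by
    intro s
    induction s with
    | zero =>
      intro r n h η
      obtain rfl : r = n := by omega
      exact ⟨η, Ext.mk₀_id_comp η⟩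
    | succ s ih =>
      intro r n h η
      obtain ⟨ξ, rfl⟩ := ih (r + 1) n (by omega) η
      have : Projective (coverSequence (syzygy M s)).X₂ :=
        ModuleCat.projective_of_free (Module.Free.chooseBasis A (minimalFreeCover (syzygy M s)))
      obtain ⟨ζ, rfl⟩ := precomp_extClass_surjective_of_projective_X₂ N
        (coverSequence_shortExact (syzygy M s)) r ξ
      exact ⟨ζ, Ext.comp_assoc _ _ _ rfl (add_comm 1 r) (by omega)⟩
  obtain ⟨ξ, hξ⟩ := key n 0 n (add_zero n) η
  exact ⟨Ext.homEquiv₀ ξ, by rw [Represents, Ext.mk₀_homEquiv₀_apply, hξ]⟩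

/-- For `f : Ωˢ⁺¹ M ⟶ N` representing `η ∈ Extˢ⁺¹(M, N)`, the module `K_η`: the pushout of `f`
along the inclusion `Ωˢ⁺¹ M → Fₛ`. It sits in an exact sequence `0 → N → K_η → Ωˢ M → 0`, and up
to isomorphism it depends only on `η`. -/
def extensionModule {M N : ModuleCat.{u} A} {s : ℕ} (f : syzygy M (s + 1) ⟶ N) : ModuleCat.{u} A :=
  Limits.pushout f (syzygyInclusion M s)

/-- The finitely generated modules of free reducible complexity. -/
inductive FreeReducibleComplexity : ModuleCat.{u} A → Prop
  /-- Every finitely generated module of finite projective dimension is in the class. -/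
  | of_finite_projectiveDimension (X : ModuleCat.{u} A) (hfg : Module.Finite A X)
      (hpd : projectiveDimension X < ⊤) : FreeReducibleComplexity X
  /-- A finitely generated module `X` of finite positive complexity is in the class if there is
  `η ∈ Extˢ⁺¹(X, X)` such that `K_η` is in the class and has complexity `cx X - 1`. -/
  | of_reducing (X : ModuleCat.{u} A) (hfg : Module.Finite A X)
      (hpos : 0 < complexity X) (hfin : complexity X < ⊤)
      (s : ℕ) (η : Ext.{u} X X (s + 1)) (f : syzygy X (s + 1) ⟶ X) (hf : Represents f η)
      (hcx : complexity (extensionModule f) = complexity X - 1)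
      (hK : FreeReducibleComplexity (extensionModule f)) : FreeReducibleComplexity X

end FreeRedCx

end

/-!
The forward implication is immediate, since `Ext` out of a module of finite projective dimension
vanishes in large degrees.

For the converse, let `X` be a member of the class which is reduced by a class in `Extˢ⁺¹(X, X)`,
so that there is an exact sequence `0 → X → K → Ωˢ X → 0` with `K` again in the class and of
complexity `cx X - 1` (`extensionSequence_shortExact`). If `Extⁱ(X, N)` vanishes for large `i`,
then so does `Extⁱ(K, N)`, because `Extⁱ(Ωˢ X, N)` embeds in `Extⁱ⁺ˢ(X, N)` for `i > 0`
(`eventually_subsingleton_ext_extensionModule`). By induction `K` has finite projective dimension.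
Over a local ring this forces `cx K = 0` (`complexity_eq_zero_of_hasProjectiveDimensionLT`), hence
`cx X = 1`, and `N = X` is an admissible test module: `Extⁱ(X, X) = 0` for large `i`.

Let `θ ∈ Extˢ⁺¹(X, X)` be the Yoneda product of the class of `0 → Ωˢ X → ⋯ → X → 0` with the class
of `0 → X → K → Ωˢ X → 0`. Since `K` has finite projective dimension, multiplication by `θ` is
injective on `Extⁱ(X, Y)` for all `Y` and all `i` beyond a bound which is independent of `Y`. As
`Extⁱ(X, X) = 0` for large `i`, the class `θ` is nilpotent, so that these groups
vanish and `X` has finite projective dimension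
(`hasProjectiveDimensionLT_of_extensionModule`).
-/

namespace FreeRedCx

/-! ### Pushouts of short exact sequences -/

section Pushout

variable {C : Type*} [Category* C] [Abelian C]

/-- The pushout `N → P → X₃` of a short complex `X₁ → X₂ → X₃` along a map `X₁ ⟶ N`. -/
noncomputable abbrev pushoutSequence (S : ShortComplex C) {N : C} (f : S.X₁ ⟶ N) :
    ShortComplex C :=
  ShortComplex.mk (Limits.pushout.inl f S.f)
    (Limits.pushout.desc (f := f) (g := S.f) 0 S.g (by simp))
    (Limits.pushout.inl_desc _ _ _)

theorem shortExact_pushoutSequence {S : ShortComplex C} (hS : S.ShortExact) {N : C}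
    (f : S.X₁ ⟶ N) : (pushoutSequence S f).ShortExact := by
  have := hS.mono_f
  have := hS.epi_g
  have hepi : Epi (Limits.pushout.desc (f := f) (g := S.f) 0 S.g (by simp)) :=
    epi_of_epi_fac (Limits.pushout.inr_desc _ _ _)
  have hmono : Mono (Limits.pushout.inl f S.f) := inferInstance
  refine { exact := ?_, mono_f := hmono, epi_g := hepi }
  refine ShortComplex.exact_of_g_is_cokernel _ (Limits.CokernelCofork.IsColimit.ofπ' _ _ ?_)
  intro Z k hk
  have h : S.f ≫ Limits.pushout.inr f S.f ≫ k = 0 := by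
    rw [← Limits.pushout.condition_assoc, hk, Limits.comp_zero]
  refine ⟨hS.gIsCokernel.desc (Limits.CokernelCofork.ofπ _ h), ?_⟩
  apply Limits.pushout.hom_ext
  · dsimp at hk ⊢
    rw [Limits.pushout.inl_desc_assoc, Limits.zero_comp, hk]
  · dsimp
    rw [Limits.pushout.inr_desc_assoc]
    exact hS.gIsCokernel.fac (Limits.CokernelCofork.ofπ _ h) Limits.WalkingParallelPair.one

end Pushout

/-! ### Dimension shifting and the reducing sequence -/

section Ring

variable {A : Type u} [CommRing A]

instance projective_coverSequence_X₂ (M : ModuleCat.{u} A) : Projective (coverSequence M).X₂ :=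
  ModuleCat.projective_of_free (Module.Free.chooseBasis A (minimalFreeCover M))

/-- The complex `0 → N → K_f → Ωˢ M → 0`, where `K_f` is the extension module of
`f : Ωˢ⁺¹ M ⟶ N`. -/
noncomputable abbrev extensionSequence {M N : ModuleCat.{u} A} {s : ℕ}
    (f : syzygy M (s + 1) ⟶ N) : ShortComplex (ModuleCat.{u} A) :=
  pushoutSequence (syzygySequence M s) f

theorem extensionSequence_shortExact {M N : ModuleCat.{u} A} {s : ℕ}
    (f : syzygy M (s + 1) ⟶ N) : (extensionSequence f).ShortExact :=
  shortExact_pushoutSequence (coverSequence_shortExact (syzygy M s)) f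

/-- Dimension shifting: composition with the class of `0 → Ωⁿ M → Fₙ₋₁ → ⋯ → F₀ → M → 0` is
injective on `Extⁱ(Ωⁿ M, Y)` for `i > 0`. -/
theorem eq_zero_of_syzygyClass_comp_eq_zero {M Y : ModuleCat.{u} A} (n : ℕ) {i j : ℕ}
    (hi : 0 < i) (h : n + i = j) (x : Ext.{u} (syzygy M n) Y i)
    (hx : (syzygyClass M n).comp x h = 0) : x = 0 := by
  induction n generalizing i j with
  | zero =>
    obtain rfl : i = j := by omega
    exact (Ext.mk₀_id_comp x).symm.trans hx
  | succ n ih =>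
    have hS := coverSequence_shortExact (syzygy M n)
    have h1 : hS.extClass.comp x rfl = 0 := by
      refine ih (by omega) (show n + (1 + i) = j by omega) _ ?_
      exact (Ext.comp_assoc (syzygyClass M n) hS.extClass x rfl rfl (by omega)).symm.trans hx
    obtain ⟨y, rfl⟩ := Ext.contravariant_sequence_exact₁ hS Y x rfl h1
    rw [y.eq_zero_of_hasProjectiveDimensionLT 1 hi]
    exact Ext.comp_zero (Ext.mk₀ (coverSequence (syzygy M n)).f) Y i i (zero_add i)

theorem eventually_subsingleton_ext_extensionModule {X Y : ModuleCat.{u} A} {s : ℕ}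
    (f : syzygy X (s + 1) ⟶ X)
    (h : ∃ n₀ : ℕ, ∀ i : ℕ, n₀ ≤ i → Subsingleton (Ext.{u} X Y i)) :
    ∃ n₀ : ℕ, ∀ i : ℕ, n₀ ≤ i → Subsingleton (Ext.{u} (extensionModule f) Y i) := by
  obtain ⟨n₀, h⟩ := h
  refine ⟨n₀ + 1, fun i hi ↦ subsingleton_of_forall_eq 0 fun x ↦ ?_⟩
  have := h i (by omega)
  have := h (s + i) (by omega)
  -- `x` restricts to zero on `X`, hence comes from a class `y` on `Ωˢ X`.
  obtain ⟨y, rfl⟩ := Ext.contravariant_sequence_exact₂ (extensionSequence_shortExact f) Y x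
    (Subsingleton.elim (α := Ext X Y i) _ _)
  have hy := eq_zero_of_syzygyClass_comp_eq_zero s (by omega) rfl y (Subsingleton.elim _ _)
  rw [hy]
  exact Ext.comp_zero (Ext.mk₀ (extensionSequence f).g) Y i i (zero_add i)

/-- If `θ ∈ Extᵈ(X, X)` with `d > 0` acts injectively on `Extⁱ(X, Y)` for all `i ≥ n` and all `Y`,
and `Extⁱ(X, X)` vanishes for large `i`, then `Extⁱ(X, Y) = 0` for all `i ≥ n`: some power of `θ`
is zero, and it still acts injectively. -/
theorem hasProjectiveDimensionLT_of_injective_comp {X : ModuleCat.{u} A} {d n : ℕ} (hd : 0 < d)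
    (θ : Ext.{u} X X d)
    (hθ : ∀ (Y : ModuleCat.{u} A) (i : ℕ), n ≤ i → ∀ x : Ext.{u} X Y i,
      θ.comp x rfl = 0 → x = 0)
    (h : ∃ n₀ : ℕ, ∀ i : ℕ, n₀ ≤ i → Subsingleton (Ext.{u} X X i)) :
    HasProjectiveDimensionLT X n := by
  have hpow : ∀ m : ℕ, ∃ ξ : Ext.{u} X X (m * d), ∀ (Y : ModuleCat.{u} A) (i j : ℕ), n ≤ i →
      ∀ (x : Ext.{u} X Y i) (hj : m * d + i = j), ξ.comp x hj = 0 → x = 0 := by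
    intro m
    induction m with
    | zero =>
      rw [Nat.zero_mul]
      refine ⟨Ext.mk₀ (𝟙 X), fun Y i j _ x hj hx ↦ ?_⟩
      obtain rfl : i = j := by omega
      exact (Ext.mk₀_id_comp x).symm.trans hx
    | succ m ih =>
      obtain ⟨ξ, hξ⟩ := ih
      have hm : m * d + d = (m + 1) * d := by ring
      refine ⟨ξ.comp θ hm, fun Y i j hi x hj hx ↦ hθ Y i hi x
        (hξ Y (d + i) j (by omega) _ (by omega) ?_)⟩
      exact (Ext.comp_assoc ξ θ x hm rfl (by omega)).symm.trans hx
  obtain ⟨n₀, h⟩ := h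
  obtain ⟨ξ, hξ⟩ := hpow n₀
  have := h (n₀ * d) (Nat.le_mul_of_pos_right _ hd)
  refine HasProjectiveDimensionLT.mk fun i hi Y x ↦ hξ Y i _ hi x rfl ?_
  rw [Subsingleton.elim ξ 0, Ext.zero_comp]

/-- The connecting maps `Extⁱ(X, Y) → Extⁱ⁺¹(Ωˢ X, Y)` of `0 → X → K → Ωˢ X → 0` are injective
where `Extⁱ(K, Y) = 0`, so their composites with dimension shifting give an injective action of a
class of positive degree on `Extⁱ(X, Y)`. -/
theorem hasProjectiveDimensionLT_of_extensionModule {X : ModuleCat.{u} A} {s n : ℕ}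
    (f : syzygy X (s + 1) ⟶ X) (hK : HasProjectiveDimensionLT (extensionModule f) n)
    (h : ∃ n₀ : ℕ, ∀ i : ℕ, n₀ ≤ i → Subsingleton (Ext.{u} X X i)) :
    HasProjectiveDimensionLT X n := by
  have hS := extensionSequence_shortExact f
  refine hasProjectiveDimensionLT_of_injective_comp (Nat.succ_pos s)
    ((syzygyClass X s).comp hS.extClass rfl) (fun Y i hi x hx ↦ ?_) h
  rw [Ext.comp_assoc _ _ _ rfl rfl (by omega)] at hx
  obtain ⟨y, rfl⟩ := Ext.contravariant_sequence_exact₁ hS Y x rfl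
    (eq_zero_of_syzygyClass_comp_eq_zero s (by omega) _ _ hx)
  have hy : y = 0 := Ext.eq_zero_of_hasProjectiveDimensionLT (X := extensionModule f) y n hi
  rw [hy, Ext.comp_zero]

theorem hasProjectiveDimensionLT_syzygy {X : ModuleCat.{u} A} {n : ℕ}
    (h : HasProjectiveDimensionLT X (n + 1)) : HasProjectiveDimensionLT (syzygy X n) 1 := by
  have key : ∀ k m : ℕ, k + m = n → HasProjectiveDimensionLT (syzygy X k) (m + 1) := by
    intro k
    induction k with
    | zero =>
      rintro m hm
      obtain rfl : m = n := by omega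
      exact h
    | succ k ih =>
      intro m hm
      exact ((coverSequence_shortExact (syzygy X k)).hasProjectiveDimensionLT_X₃_iff m
        inferInstance).1 (ih (m + 1) (by omega))
  exact key n 0 rfl

/-! ### Minimal free covers and finite resolutions -/

theorem finite_generators (M : ModuleCat.{u} A) [hM : Module.Finite A M] :
    Finite (Submodule.generators (⊤ : Submodule A M)) :=
  (Submodule.FG.finite_generators hM.fg_top).to_subtype

theorem finrank_minimalFreeCover [Nontrivial A] (M : ModuleCat.{u} A) [hM : Module.Finite A M] :
    Module.finrank A (minimalFreeCover M) = (⊤ : Submodule A M).spanFinrank := by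
  have := finite_generators M
  have := Fintype.ofFinite (Submodule.generators (⊤ : Submodule A M))
  rw [Module.finrank_finsupp_self, ← Nat.card_eq_fintype_card, ← hM.fg_top.generators_ncard]
  rfl

instance finite_syzygy [IsNoetherianRing A] (M : ModuleCat.{u} A) [hM : Module.Finite A M]
    (n : ℕ) : Module.Finite A (syzygy M n) := by
  induction n with
  | zero => exact hM
  | succ n ih =>
    have := finite_generators (syzygy M n)
    exact inferInstanceAs (Module.Finite A (LinearMap.ker (coverMap (syzygy M n))))

/-- The minimal free cover of a free module of finite rank is an isomorphism: it is a surjection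
between free modules of the same finite rank. -/
theorem coverMap_injective_of_free [Nontrivial A] (M : ModuleCat.{u} A) [Module.Finite A M]
    [Module.Free A M] : Function.Injective (coverMap M) := by
  have := finite_generators M
  have e : M ≃ₗ[A] minimalFreeCover M := LinearEquiv.ofFinrankEq _ _ (by
    rw [finrank_minimalFreeCover, Module.finrank_eq_spanFinrank_of_free])
  have hs : Function.Surjective (e.toLinearMap ∘ₗ coverMap M) :=
    e.surjective.comp (coverMap_surjective M)
  have hinj := OrzechProperty.injective_of_surjective_endomorphism _ hs
  rw [LinearMap.coe_comp] at hinj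
  exact hinj.of_comp

theorem subsingleton_syzygy_one_of_subsingleton (M : ModuleCat.{u} A) [Subsingleton M] :
    Subsingleton (syzygy M 1) := by
  -- A minimal generating set of the zero module is empty, so the cover itself is zero.
  have : IsEmpty (Submodule.generators (⊤ : Submodule A M)) := by
    rw [← Cardinal.mk_eq_zero_iff, Submodule.generators_card,
      Submodule.spanRank_eq_zero_iff_eq_bot]
    exact Subsingleton.elim _ _
  exact inferInstanceAs (Subsingleton (LinearMap.ker (coverMap M)))

theorem exists_hasProjectiveDimensionLT {X : ModuleCat.{u} A} (h : projectiveDimension X < ⊤) :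
    ∃ n : ℕ, HasProjectiveDimensionLT X (n + 1) :=
  (projectiveDimension_ne_top_iff X).1 h.ne

theorem FreeReducibleComplexity.finite {X : ModuleCat.{u} A} (h : FreeReducibleComplexity X) :
    Module.Finite A X := by
  cases h <;> assumption

variable [IsLocalRing A] [IsNoetherianRing A]

/-- Over a Noetherian local ring, the minimal free resolution of a finitely generated module of
finite projective dimension is finite. -/
theorem subsingleton_syzygy {X : ModuleCat.{u} A} [Module.Finite A X] {n : ℕ}
    (h : HasProjectiveDimensionLT X (n + 1)) (m : ℕ) (hm : n + 1 ≤ m) :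
    Subsingleton (syzygy X m) := by
  induction m, hm using Nat.le_induction with
  | base =>
    have := hasProjectiveDimensionLT_syzygy h
    have : Module.Projective A (syzygy X n) :=
      (IsProjective.iff_projective _).2 inferInstance
    have : Module.Free A (syzygy X n) := Module.free_of_flat_of_isLocalRing
    have hker : LinearMap.ker (coverMap (syzygy X n)) = ⊥ :=
      LinearMap.ker_eq_bot.2 (coverMap_injective_of_free (syzygy X n))
    exact (Submodule.subsingleton_iff_eq_bot (p := LinearMap.ker (coverMap (syzygy X n)))).2 hker
  | succ m _ ih => exact subsingleton_syzygy_one_of_subsingleton (syzygy X m)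

theorem complexity_eq_zero_of_hasProjectiveDimensionLT {X : ModuleCat.{u} A} [Module.Finite A X]
    {n : ℕ} (h : HasProjectiveDimensionLT X (n + 1)) : complexity X = 0 := by
  refine le_antisymm (sInf_le ⟨0, rfl, 0, ?_⟩) zero_le
  -- For `t = 0` and `a = 0` the bound says that `βₘ(X) = 0`.
  filter_upwards [Filter.eventually_ge_atTop (n + 1)] with m hm
  have := subsingleton_syzygy h m hm
  rw [betti, finrank_minimalFreeCover, Subsingleton.elim (⊤ : Submodule A (syzygy X m)) ⊥,
    Submodule.spanFinrank_bot]
  simp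

/-! ### Detection of finite projective dimension -/

theorem projectiveDimension_lt_top_of_ext {M : ModuleCat.{u} A} (hM : FreeReducibleComplexity M)
    (h : ∀ N : ModuleCat.{u} A, FreeReducibleComplexity N → complexity N = 1 →
      ∃ n₀ : ℕ, ∀ i : ℕ, n₀ ≤ i → Subsingleton (Ext.{u} M N i)) :
    projectiveDimension M < ⊤ := by
  induction hM with
  | of_finite_projectiveDimension X hfg hpd => exact hpd
  | of_reducing X hfg hpos hfin s η f hf hcx hK ih =>
    obtain ⟨n, hn⟩ := exists_hasProjectiveDimensionLT
      (ih fun N hN hN1 ↦ eventually_subsingleton_ext_extensionModule f (h N hN hN1))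
    have := hK.finite
    -- `K` has finite projective dimension, so `cx X - 1 = cx K = 0`.
    have hle : complexity X ≤ 1 := by
      rw [← tsub_eq_zero_iff_le, ← hcx, complexity_eq_zero_of_hasProjectiveDimensionLT hn]
    have hX1 : complexity X = 1 := le_antisymm hle (Order.one_le_iff_pos.2 hpos)
    have hX : FreeReducibleComplexity X := .of_reducing X hfg hpos hfin s η f hf hcx hK
    have := hasProjectiveDimensionLT_of_extensionModule f hn (h X hX hX1)
    exact ((projectiveDimension_ne_top_iff X).2 ⟨n, this⟩).lt_top

end Ring

end FreeRedCx

theorem mainTheorem3 {A : Type u} [CommRing A] [IsLocalRing A] [IsNoetherianRing A]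
    (M : ModuleCat.{u} A) (hM : FreeRedCx.FreeReducibleComplexity M) :
    projectiveDimension M < ⊤ ↔
      ∀ N : ModuleCat.{u} A, FreeRedCx.FreeReducibleComplexity N → FreeRedCx.complexity N = 1 →
        ∃ n₀ : ℕ, ∀ i : ℕ, n₀ ≤ i → Subsingleton (Ext.{u} M N i) := by
  refine ⟨fun h N _ _ ↦ ?_, FreeRedCx.projectiveDimension_lt_top_of_ext hM⟩
  obtain ⟨n, hn⟩ := FreeRedCx.exists_hasProjectiveDimensionLT h
  exact ⟨n + 1, fun i hi ↦ HasProjectiveDimensionLT.subsingleton M (n + 1) i hi N⟩
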